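/- For $\lambda\ge 0$ let $Q_\lambda(z)=\dfrac{(2+i\lambda z)^2}{4(z^2-1)}$. A *trajectory* of the quadratic differential $-Q_\lambda(z)\,dz^2$ is a maximal regular $C^1$ arc $\gamma:\mathbb{R}\to\mathbb{C}$ (maximality referring to its image) that avoids the zero and the poles of $Q_\lambda$ and along which $-Q_\lambda(z)\,dz^2>0$, that is, $-Q_\lambda(\gamma(t))\,\gamma'(t)^2\in(0,\infty)$ for all $t$. It *emanates* from $a$ if $\gamma(t)\to a$ as $t\to-\infty$, and it *joins* $a$ and $b$ if moreover $\gamma(t)\to b$ as $t\to+\infty$. It *diverges to infinity in the direction* $u$, $|u|=1$, if $|\gamma(t)|\to\infty$ and $\gamma(t)/|\gamma(t)|\to u$ as $t\to+\infty$. **Lemma.** The equation $$2\log\left(\frac{2+\sqrt{\lambda^2+4}}{\lambda}\right)-\sqrt{\lambda^2+4}=0$$ has exactly one positive solution $\lambda=\lambda_0$, and the following holds. 1. If $0\le\lambda<\lambda_0$, then there exists a trajectory of $-Q_\lambda(z)\,dz^2$ that joins the points $z=1$ and $z=-1$. 2. If $\lambda>\lambda_0$, then trajectories of $-Q_\lambda(z)\,dz^2$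 emanating from $z=1$ and from $z=-1$ exist, and they diverge to infinity in opposite directions: there is $u\in\mathbb{C}$ with $|u|=1$ such that every trajectory emanating from $z=1$ diverges to infinity in the direction $u$ and every trajectory emanating from $z=-1$ diverges to infinity in the direction $-u$. -/

import Mathlib

open Filter Topology

/-- The function `h(lam) = 2 log ((2 + √(lam² + 4)) / lam) - √(lam² + 4)`, for `lam > 0`. -/
noncomputable def hFun (lam : ℝ) : ℝ :=
  2 * Real.log ((2 + Real.sqrt (lam ^ 2 + 4)) / lam) - Real.sqrt (lam ^ 2 + 4)

/-- The function `Q_lam(z) = (2 + i lam z)² / (4 (z² - 1))`.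
At the poles `z = ±1` Lean assigns it the value `0`. -/
noncomputable def Q (lam : ℝ) (z : ℂ) : ℂ :=
  (2 + Complex.I * (lam : ℂ) * z) ^ 2 / (4 * (z ^ 2 - 1))

/-- A horizontal arc of the quadratic differential `q(z) dz²`: a continuously differentiable curve
(parametrized, without loss of generality, by the open interval `ℝ`) along which `q(z) dz² > 0`.
In particular the velocity never vanishes, and the curve avoids every point where `q` takes the
value `0`: for `q = -Q lam` these are all the finite critical points (zero and poles). -/
def IsHorizontalArc (q : ℂ → ℂ) (γ : ℝ → ℂ) : Prop :=
  ContDiff ℝ 1 γ ∧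
    ∀ t : ℝ, (q (γ t) * (deriv γ t) ^ 2).im = 0 ∧ 0 < (q (γ t) * (deriv γ t) ^ 2).re

/-- `γ` parametrizes a trajectory of `q(z) dz²`: a horizontal arc that is maximal, i.e. whose
image is not properly contained in the image of another horizontal arc. -/
def IsTrajectory (q : ℂ → ℂ) (γ : ℝ → ℂ) : Prop :=
  IsHorizontalArc q γ ∧
    ∀ δ : ℝ → ℂ, IsHorizontalArc q δ → Set.range γ ⊆ Set.range δ → Set.range δ = Set.range γ

/-- The curve `γ` emanates from the point `a`. (An orientation in which `γ` ends at `a` is covered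
by reversing the parameter.) -/
def EmanatesFrom (γ : ℝ → ℂ) (a : ℂ) : Prop := Tendsto γ atBot (𝓝 a)

/-- The curve `γ` ends at the point `b`. -/
def EndsAt (γ : ℝ → ℂ) (b : ℂ) : Prop := Tendsto γ atTop (𝓝 b)

/-- The curve `γ` diverges to infinity in the direction of the unit vector `u`:
`|γ(t)| → ∞` and `γ(t) / |γ(t)| → u`. -/
def DivergesInDirection (γ : ℝ → ℂ) (u : ℂ) : Prop :=
  Tendsto (fun t => ‖γ t‖) atTop atTop ∧ Tendsto (fun t => γ t / (‖γ t‖ : ℂ)) atTop (𝓝 u)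

/-! ### The hyperbolic cosine in coordinates -/

/-! Under `z = cosh w`, w = u + iv, the form Q dz² becomes the perfect square (1 + i(λ/2) cosh w)²
dw², the square of dP with P(w) = w + i(λ/2) sinh w. Hence -Q dz² > 0 says that dP is purely
imaginary along the arc, so Re P = u - (λ/2) cosh u sin v is constant on it. This function vanishes
over z = ±1, so every arc emanating from these points lies on the curve u / cosh u = (λ/2) sin v.

The function u / cosh u has maximum a / cosh a, attained at the positive root a of a sinh a = cosh
a, and λ₀ = 2a / cosh a = 2 / sinh a. If λ < λ₀, the equation is solved for u with |u| < a as a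
function of v; letting v run over (0, π) gives an arc from 1 to -1 (`exists_trajectory_joining`). If
λ > λ₀, it is solved for v as a function of u; letting u run over (0, ∞) gives v → 0, hence an arc
from 1 to infinity in the direction 1 (`isTrajectory_escape`, `tendsto_cosh_escapeLift`). The
reflection z ↦ -conj z transfers this to -1.

Maximality is a connectedness argument: by `IsHorizontalArc.levelSq_eq` a larger arc stays on the
zero level, and it cannot cross a barrier that this level misses. The barrier is the ellipse |u| = a
below λ₀ and the imaginary axis above λ₀. -/

theorem Complex.cosh_eq_re_im (w : ℂ) :
    Complex.cosh w = ((Real.cosh w.re * Real.cos w.im : ℝ) : ℂ) +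
      ((Real.sinh w.re * Real.sin w.im : ℝ) : ℂ) * Complex.I := by
  have h := Complex.cosh_add w.re (w.im * Complex.I)
  rw [Complex.re_add_im, Complex.cosh_mul_I, Complex.sinh_mul_I] at h
  rw [h]; push_cast; ring

theorem Complex.sinh_eq_re_im (w : ℂ) :
    Complex.sinh w = ((Real.sinh w.re * Real.cos w.im : ℝ) : ℂ) +
      ((Real.cosh w.re * Real.sin w.im : ℝ) : ℂ) * Complex.I := by
  have h := Complex.sinh_add w.re (w.im * Complex.I)
  rw [Complex.re_add_im, Complex.cosh_mul_I, Complex.sinh_mul_I] at h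
  rw [h]; push_cast; ring

theorem Complex.cosh_re_eq (w : ℂ) :
    (Complex.cosh w).re = Real.cosh w.re * Real.cos w.im := by
  rw [Complex.cosh_eq_re_im, Complex.add_re, Complex.re_ofReal_mul, Complex.I_re,
    Complex.ofReal_re, mul_zero, add_zero]

theorem Complex.cosh_im_eq (w : ℂ) :
    (Complex.cosh w).im = Real.sinh w.re * Real.sin w.im := by
  rw [Complex.cosh_eq_re_im, Complex.add_im, Complex.im_ofReal_mul, Complex.I_im,
    Complex.ofReal_im, mul_one, zero_add]

theorem Complex.sinh_im_eq (w : ℂ) :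
    (Complex.sinh w).im = Real.cosh w.re * Real.sin w.im := by
  rw [Complex.sinh_eq_re_im, Complex.add_im, Complex.im_ofReal_mul, Complex.I_im,
    Complex.ofReal_im, mul_one, zero_add]

theorem Complex.cosh_surjective : Function.Surjective Complex.cosh := by
  intro z
  obtain ⟨x, rfl⟩ := Complex.cos_surjective z
  exact ⟨x * Complex.I, Complex.cosh_mul_I x⟩

theorem Complex.norm_cosh_add_one (w : ℂ) :
    ‖Complex.cosh w + 1‖ = Real.cosh w.re + Real.cos w.im := by
  have h1 := Real.one_le_cosh w.re
  have h2 := Real.neg_one_le_cos w.im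
  have h3 := Real.cosh_sq w.re
  have h4 := Real.sin_sq_add_cos_sq w.im
  have h : ‖Complex.cosh w + 1‖ ^ 2 = (Real.cosh w.re + Real.cos w.im) ^ 2 := by
    rw [← Complex.normSq_eq_norm_sq, Complex.normSq_apply]
    simp only [Complex.add_re, Complex.add_im, Complex.one_re, Complex.one_im, Complex.cosh_re_eq,
      Complex.cosh_im_eq]
    linear_combination (-Real.sin w.im ^ 2) * h3 + (Real.cosh w.re ^ 2 - 1) * h4
  exact (sq_eq_sq₀ (norm_nonneg _) (by linarith)).1 h

theorem Complex.norm_cosh_sub_one (w : ℂ) :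
    ‖Complex.cosh w - 1‖ = Real.cosh w.re - Real.cos w.im := by
  have h1 := Real.one_le_cosh w.re
  have h2 := Real.cos_le_one w.im
  have h3 := Real.cosh_sq w.re
  have h4 := Real.sin_sq_add_cos_sq w.im
  have h : ‖Complex.cosh w - 1‖ ^ 2 = (Real.cosh w.re - Real.cos w.im) ^ 2 := by
    rw [← Complex.normSq_eq_norm_sq, Complex.normSq_apply]
    simp only [Complex.sub_re, Complex.sub_im, Complex.one_re, Complex.one_im, Complex.cosh_re_eq,
      Complex.cosh_im_eq]
    linear_combination (-Real.sin w.im ^ 2) * h3 + (Real.cosh w.re ^ 2 - 1) * h4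
  exact (sq_eq_sq₀ (norm_nonneg _) (by linarith)).1 h

/-- Half the sum of the distances to the foci `1` and `-1`. -/
noncomputable def focalMean (z : ℂ) : ℝ := (‖z - 1‖ + ‖z + 1‖) / 2

/-- This recovers |Re w| continuously from z, with no choice of a branch of the inverse of `cosh`.
-/
theorem focalMean_cosh (w : ℂ) : focalMean (Complex.cosh w) = Real.cosh w.re := by
  rw [focalMean, Complex.norm_cosh_add_one, Complex.norm_cosh_sub_one]; ring

theorem continuous_focalMean : Continuous focalMean := by
  unfold focalMean; fun_prop

theorem cosh_eq_cosh_of_re_of_cos_of_sin {w w' : ℂ} (h : w.re = w'.re)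
    (hc : Real.cos w.im = Real.cos w'.im) (hs : Real.sin w.im = Real.sin w'.im) :
    Complex.cosh w = Complex.cosh w' := by
  apply Complex.ext <;> simp [Complex.cosh_re_eq, Complex.cosh_im_eq, h, hc, hs]

/-! ### The level function of the vertical foliation of `Q`, in the coordinate `z = cosh w` -/

/-- The primitive of the square root of `Q lam` in the coordinate `z = cosh w`. -/
noncomputable def period (lam : ℝ) (w : ℂ) : ℂ := w + Complex.I * (lam / 2) * Complex.sinh w

/-- The real part of the primitive of the square root of `Q lam`. -/
noncomputable def level (lam : ℝ) (w : ℂ) : ℝ := (period lam w).re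

theorem level_eq (lam : ℝ) (w : ℂ) :
    level lam w = w.re - lam / 2 * Real.cosh w.re * Real.sin w.im := by
  have : (lam / 2 : ℂ) = ((lam / 2 : ℝ) : ℂ) := by push_cast; rfl
  rw [level, period, this]
  simp only [Complex.add_re, Complex.mul_re, Complex.mul_im, Complex.I_re, Complex.I_im,
    Complex.ofReal_re, Complex.ofReal_im, Complex.sinh_im_eq]
  ring

theorem level_neg (lam : ℝ) (w : ℂ) : level lam (-w) = -level lam w := by
  simp [level_eq]; ring

theorem hasDerivAt_period (lam : ℝ) (w : ℂ) :
    HasDerivAt (period lam) (1 + Complex.I * (lam / 2) * Complex.cosh w) w :=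
  (hasDerivAt_id w).add ((Complex.hasDerivAt_sinh w).const_mul _)

/-- Two preimages of a point under `cosh` differ by a sign and a multiple of 2πi. The level is odd
and 2πi-periodic, so only its sign is ambiguous. -/
theorem level_sq_eq_of_cosh_eq (lam : ℝ) {w w' : ℂ} (h : Complex.cosh w = Complex.cosh w') :
    level lam w ^ 2 = level lam w' ^ 2 := by
  rw [← Complex.cos_mul_I, ← Complex.cos_mul_I, Complex.cos_eq_cos_iff] at h
  obtain ⟨k, h | h⟩ := h
  · have : w' = w + ((-k * (2 * Real.pi) : ℝ) : ℂ) * Complex.I := by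
      apply mul_right_cancel₀ Complex.I_ne_zero
      rw [h]; push_cast
      linear_combination (2 * k * Real.pi : ℂ) * Complex.I_sq
    rw [this, level_eq, level_eq]
    have := Real.sin_add_int_mul_two_pi w.im (-k)
    push_cast at this
    rw [neg_mul] at this
    simp [this]
  · have : w' = -(w + ((k * (2 * Real.pi) : ℝ) : ℂ) * Complex.I) := by
      apply mul_right_cancel₀ Complex.I_ne_zero
      rw [h]; push_cast
      linear_combination (2 * k * Real.pi : ℂ) * Complex.I_sq
    rw [this, level_neg, level_eq, level_eq]
    have := Real.sin_add_int_mul_two_pi w.im k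
    simp [this]
    ring

/-- The square of the level function; unlike the level function itself it descends to the
`z`-plane. -/
noncomputable def levelSq (lam : ℝ) (z : ℂ) : ℝ :=
  level lam (Function.surjInv Complex.cosh_surjective z) ^ 2

theorem levelSq_cosh (lam : ℝ) (w : ℂ) : levelSq lam (Complex.cosh w) = level lam w ^ 2 :=
  level_sq_eq_of_cosh_eq lam (Function.surjInv_eq Complex.cosh_surjective _)

theorem tendsto_levelSq_nhds_one (lam : ℝ) : Tendsto (levelSq lam) (𝓝 1) (𝓝 0) := by
  -- The chosen preimage need not depend continuously on z, so the level is dominated by a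
  -- continuous function of z vanishing at 1, using (x - y)² ≤ 2x² + 2y² and u² ≤ 2(cosh u - 1).
  have hbound : ∀ z : ℂ, levelSq lam z ≤
      2 * (2 * (focalMean z - 1)) +
        2 * ((lam / 2 * focalMean z) ^ 2 * (1 - ((‖z + 1‖ - ‖z - 1‖) / 2) ^ 2)) := by
    intro z
    obtain ⟨w, rfl⟩ := Complex.cosh_surjective z
    have hc : (‖Complex.cosh w + 1‖ - ‖Complex.cosh w - 1‖) / 2 = Real.cos w.im := by
      rw [Complex.norm_cosh_add_one, Complex.norm_cosh_sub_one]; ring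
    rw [levelSq_cosh, focalMean_cosh, hc, level_eq, ← Real.sin_sq]
    have h : w.re ^ 2 ≤ 2 * (Real.cosh w.re - 1) := by
      have h1 : (w.re / 2) ^ 2 ≤ Real.sinh (w.re / 2) ^ 2 := by
        rw [sq_le_sq]
        · rcases le_total 0 (w.re / 2) with h | h
          · rw [abs_of_nonneg h, abs_of_nonneg (Real.sinh_nonneg_iff.2 h)]
            exact Real.self_le_sinh_iff.2 h
          · rw [abs_of_nonpos h, abs_of_nonpos (Real.sinh_nonpos_iff.2 h)]
            exact neg_le_neg (Real.sinh_le_self_iff.2 h)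
      have h2 := Real.cosh_two_mul (w.re / 2)
      have h3 := Real.cosh_sq (w.re / 2)
      rw [mul_div_cancel₀ _ two_ne_zero] at h2
      nlinarith
    nlinarith [sq_nonneg (w.re + lam / 2 * Real.cosh w.re * Real.sin w.im)]
  refine squeeze_zero (fun z => sq_nonneg _) hbound ?_
  have hcont : Continuous fun z : ℂ => 2 * (2 * (focalMean z - 1)) +
        2 * ((lam / 2 * focalMean z) ^ 2 * (1 - ((‖z + 1‖ - ‖z - 1‖) / 2) ^ 2)) := by
    have := continuous_focalMean
    fun_prop
  convert hcont.tendsto 1 using 2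
  norm_num [focalMean]

theorem Q_cosh_mul_sq (lam : ℝ) {w : ℂ} (hw : Complex.sinh w ≠ 0) (v : ℂ) :
    Q lam (Complex.cosh w) * (Complex.sinh w * v) ^ 2 =
      ((1 + Complex.I * (lam / 2) * Complex.cosh w) * v) ^ 2 := by
  have h : Complex.cosh w ^ 2 - 1 = Complex.sinh w ^ 2 := (Complex.sinh_sq w).symm
  rw [Q, h]
  field_simp
  ring

/-! ### Horizontal arcs and level curves -/

theorem IsHorizontalArc.ne_one {lam : ℝ} {γ : ℝ → ℂ}
    (h : IsHorizontalArc (fun z => -Q lam z) γ) (t : ℝ) : γ t ≠ 1 := by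
  intro h1
  have := (h.2 t).2
  simp [h1, Q] at this

theorem IsHorizontalArc.ne_neg_one {lam : ℝ} {γ : ℝ → ℂ}
    (h : IsHorizontalArc (fun z => -Q lam z) γ) (t : ℝ) : γ t ≠ -1 := by
  intro h1
  have := (h.2 t).2
  simp [h1, Q] at this

theorem IsHorizontalArc.deriv_ne_zero {q : ℂ → ℂ} {γ : ℝ → ℂ}
    (h : IsHorizontalArc q γ) (t : ℝ) : deriv γ t ≠ 0 := by
  intro h1
  have := (h.2 t).2
  simp [h1] at this

theorem Complex.sinh_ne_zero_of_cosh_ne {w : ℂ} (h1 : Complex.cosh w ≠ 1)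
    (h2 : Complex.cosh w ≠ -1) : Complex.sinh w ≠ 0 := by
  intro h
  have := Complex.cosh_sq w
  rw [h] at this
  have : Complex.cosh w ^ 2 = 1 := by simpa using this
  rcases sq_eq_one_iff.1 this with h | h <;> contradiction

/-- Lift the arc locally by an inverse branch of `cosh`. The velocity X of `period` along the lift
satisfies -X² > 0, so Re X = 0 and the level has zero derivative. -/
theorem IsHorizontalArc.levelSq_eq {lam : ℝ} {γ : ℝ → ℂ}
    (h : IsHorizontalArc (fun z => -Q lam z) γ) (s t : ℝ) :
    levelSq lam (γ s) = levelSq lam (γ t) := by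
  have key : ∀ t, HasDerivAt (fun t => levelSq lam (γ t)) 0 t := by
    intro t
    obtain ⟨w, hw⟩ := Complex.cosh_surjective (γ t)
    have hsinh : Complex.sinh w ≠ 0 := Complex.sinh_ne_zero_of_cosh_ne
      (hw ▸ h.ne_one t) (hw ▸ h.ne_neg_one t)
    have hcosh := Complex.hasStrictDerivAt_cosh w
    set L := hcosh.localInverse Complex.cosh (Complex.sinh w) w hsinh
    have hL : HasDerivAt L (Complex.sinh w)⁻¹ (γ t) := by
      rw [← hw]; exact (hcosh.to_localInverse hsinh).hasDerivAt
    have hLw : L (γ t) = w := by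
      rw [← hw]; exact (hcosh.eventually_left_inverse hsinh).self_of_nhds
    have hγ : HasDerivAt γ (deriv γ t) t :=
      ((h.1.differentiable one_ne_zero) t).hasDerivAt
    have hLγ : HasDerivAt (fun s => L (γ s)) ((Complex.sinh w)⁻¹ * deriv γ t) t :=
      hL.comp t hγ
    have hP : HasDerivAt (fun s => period lam (L (γ s)))
        ((1 + Complex.I * (lam / 2) * Complex.cosh w) * ((Complex.sinh w)⁻¹ * deriv γ t)) t := by
      have := hasDerivAt_period lam (L (γ t))
      rw [hLw] at this
      exact HasDerivAt.comp t (by rw [hLw]; exact this) hLγ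
    set v := (Complex.sinh w)⁻¹ * deriv γ t with hv
    set X := (1 + Complex.I * (lam / 2) * Complex.cosh w) * v with hX
    have hsq : Q lam (γ t) * (deriv γ t) ^ 2 = X ^ 2 := by
      rw [hX, ← Q_cosh_mul_sq lam hsinh, hw, hv, mul_inv_cancel_left₀ hsinh]
    have hpos := h.2 t
    simp only [neg_mul, hsq] at hpos
    simp only [Complex.neg_im, Complex.neg_re, sq, Complex.mul_im,
      Complex.mul_re] at hpos
    have hre : X.re = 0 := by
      by_contra hne
      have him : X.im = 0 := by
        have : X.re * X.im = 0 := by linarith [hpos.1]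
        exact (mul_eq_zero.1 this).resolve_left hne
      have := hpos.2
      rw [him] at this
      nlinarith [mul_self_nonneg X.re]
    have hlev : HasDerivAt (fun s => level lam (L (γ s))) 0 t := by
      have := Complex.reCLM.hasFDerivAt.comp_hasDerivAt t hP
      simpa [hre, level, Function.comp_def] using this
    have hev : ∀ᶠ s in 𝓝 t, levelSq lam (γ s) = level lam (L (γ s)) ^ 2 := by
      have h1 : ∀ᶠ z in 𝓝 (γ t), Complex.cosh (L z) = z := by
        rw [← hw]; exact hcosh.eventually_right_inverse hsinh
      filter_upwards [hγ.continuousAt.eventually h1] with s hs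
      rw [← levelSq_cosh, hs]
    have := (hlev.pow 2).congr_of_eventuallyEq (hev.mono fun s hs => by simpa using hs)
    simpa using this
  exact is_const_of_deriv_eq_zero (fun t => (key t).differentiableAt) (fun t => (key t).deriv) s t

/-- The image under `cosh` of a zero level curve is a horizontal arc. -/
theorem isHorizontalArc_cosh_comp {lam : ℝ} {w : ℝ → ℂ} (hw : ContDiff ℝ 1 w)
    (hlev : ∀ t, level lam (w t) = 0) (hd : ∀ t, deriv w t ≠ 0)
    (hs : ∀ t, Complex.sinh (w t) ≠ 0)
    (hc : ∀ t, 1 + Complex.I * (lam / 2) * Complex.cosh (w t) ≠ 0) :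
    IsHorizontalArc (fun z => -Q lam z) (fun t => Complex.cosh (w t)) := by
  refine ⟨(Complex.contDiff_cosh.restrict_scalars ℝ).comp hw, fun t => ?_⟩
  have hwt : HasDerivAt w (deriv w t) t := ((hw.differentiable one_ne_zero) t).hasDerivAt
  have hz : HasDerivAt (fun t => Complex.cosh (w t)) (Complex.sinh (w t) * deriv w t) t :=
    (Complex.hasDerivAt_cosh (w t)).comp t hwt
  have hP : HasDerivAt (fun s => period lam (w s))
        ((1 + Complex.I * (lam / 2) * Complex.cosh (w t)) * deriv w t) t :=
    (hasDerivAt_period lam (w t)).comp t hwt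
  rw [hz.deriv]
  simp only [neg_mul]
  rw [Q_cosh_mul_sq lam (hs t)]
  set X := (1 + Complex.I * (lam / 2) * Complex.cosh (w t)) * deriv w t with hX
  have hX0 : X ≠ 0 := mul_ne_zero (hc t) (hd t)
  have hre : X.re = 0 := by
    have h1 := Complex.reCLM.hasFDerivAt.comp_hasDerivAt t hP
    have h2 : (⇑Complex.reCLM ∘ fun s => period lam (w s)) = fun _ => 0 := funext hlev
    rw [h2] at h1
    simpa using h1.unique (hasDerivAt_const t 0)
  have him : X.im ≠ 0 := fun h => hX0 (Complex.ext hre h)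
  simp only [sq, Complex.neg_im, Complex.neg_re, Complex.mul_im, Complex.mul_re, hre]
  constructor
  · ring
  · nlinarith [mul_self_pos.2 him]

/-! ### The critical value of the parameter -/

/-- The derivative is u cosh u. The positive root, unique by monotonicity, is the critical point of
u / cosh u. -/
theorem strictMonoOn_mul_sinh_sub_cosh :
    StrictMonoOn (fun u : ℝ => u * Real.sinh u - Real.cosh u) (Set.Ici 0) := by
  have hd : ∀ u : ℝ, HasDerivAt (fun u : ℝ => u * Real.sinh u - Real.cosh u) (u * Real.cosh u) u := by
    intro u
    have := ((hasDerivAt_id u).mul (Real.hasDerivAt_sinh u)).sub (Real.hasDerivAt_cosh u)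
    convert! this using 1
    simp
  refine strictMonoOn_of_deriv_pos (convex_Ici 0)
    (fun u _ => (hd u).continuousAt.continuousWithinAt) fun u hu => ?_
  rw [(hd u).deriv]
  rw [interior_Ici] at hu
  exact mul_pos hu (Real.cosh_pos u)

theorem exists_mul_sinh_eq_cosh : ∃ a : ℝ, 0 < a ∧ a * Real.sinh a = Real.cosh a := by
  have h2 : (0 : ℝ) < 2 * Real.sinh 2 - Real.cosh 2 := by
    have h1 := Real.exp_pos 2
    have h3 : Real.exp (-2) ≤ 1 := Real.exp_le_one_iff.2 (by norm_num)
    have h4 : (2 : ℝ) + 1 < Real.exp 2 := Real.add_one_lt_exp two_ne_zero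
    rw [Real.sinh_eq, Real.cosh_eq]
    linarith
  have hc : ContinuousOn (fun u : ℝ => u * Real.sinh u - Real.cosh u) (Set.Icc 0 2) := by
    have := Real.continuous_sinh
    have := Real.continuous_cosh
    fun_prop
  obtain ⟨a, ha, h0⟩ := intermediate_value_Ioo (by norm_num : (0 : ℝ) ≤ 2) hc
    (show (0 : ℝ) ∈ _ from ⟨by simp, h2⟩)
  exact ⟨a, ha.1, sub_eq_zero.1 h0⟩

/-- The substitution λ = 2 / sinh b turns the logarithm into b, and the transcendental equation into
b sinh b = cosh b. -/
theorem hFun_two_div_sinh {b : ℝ} (hb : 0 < b) :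
    hFun (2 / Real.sinh b) = 2 * (b * Real.sinh b - Real.cosh b) / Real.sinh b := by
  have hs : 0 < Real.sinh b := Real.sinh_pos_iff.2 hb
  have hsq : Real.sqrt ((2 / Real.sinh b) ^ 2 + 4) = 2 * Real.cosh b / Real.sinh b := by
    have hsq : (2 / Real.sinh b) ^ 2 + 4 = (2 * Real.cosh b / Real.sinh b) ^ 2 := by
      have := Real.cosh_sq b
      field_simp
      linear_combination (-4) * this
    rw [hsq, Real.sqrt_sq (div_nonneg (by have := Real.cosh_pos b; positivity) hs.le)]
  have hlog : (2 + 2 * Real.cosh b / Real.sinh b) / (2 / Real.sinh b) = Real.exp b := by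
    rw [← Real.cosh_add_sinh]
    field_simp
    ring
  rw [hFun, hsq, hlog, Real.log_exp]
  field_simp

theorem hFun_eq_zero_iff {a lam : ℝ} (ha : 0 < a) (h : a * Real.sinh a = Real.cosh a)
    (hlam : 0 < lam) : hFun lam = 0 ↔ lam = 2 * a / Real.cosh a := by
  have hsa : 0 < Real.sinh a := Real.sinh_pos_iff.2 ha
  have hval : 2 * a / Real.cosh a = 2 / Real.sinh a := by rw [← h]; field_simp
  rw [hval]
  constructor
  · intro h0
    set b := Real.arsinh (2 / lam) with hb
    have hbpos : 0 < b := Real.arsinh_pos_iff.2 (by positivity)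
    have hsb : Real.sinh b = 2 / lam := Real.sinh_arsinh _
    have hlb : lam = 2 / Real.sinh b := by rw [hsb]; field_simp
    rw [hlb, hFun_two_div_sinh hbpos, div_eq_zero_iff] at h0
    have h1 : b * Real.sinh b - Real.cosh b = 0 := by
      rcases h0 with h0 | h0
      · linarith
      · exact absurd h0 (Real.sinh_pos_iff.2 hbpos).ne'
    have : b = a := strictMonoOn_mul_sinh_sub_cosh.injOn hbpos.le ha.le (by
      simp only [h1, h, sub_self])
    rw [hlb, this]
  · rintro rfl
    rw [hFun_two_div_sinh ha, h]; simp

/-- The convex function cosh lies above its tangent at a, and a sinh a = cosh a makes that tangent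
pass through the origin. -/
theorem abs_mul_cosh_le {a : ℝ} (ha : 0 < a) (h : a * Real.sinh a = Real.cosh a) (u : ℝ) :
    |u| * Real.cosh a ≤ a * Real.cosh u := by
  have key : Real.cosh |u| ≥ Real.cosh a + Real.sinh a * (|u| - a) := by
    have h1 : Real.exp a * (|u| - a + 1) ≤ Real.exp |u| := by
      have := mul_le_mul_of_nonneg_left (Real.add_one_le_exp (|u| - a)) (Real.exp_pos a).le
      rwa [← Real.exp_add, add_sub_cancel] at this
    have h2 : Real.exp (-a) * (a - |u| + 1) ≤ Real.exp (-|u|) := by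
      have := mul_le_mul_of_nonneg_left (Real.add_one_le_exp (a - |u|)) (Real.exp_pos (-a)).le
      rwa [← Real.exp_add, show -a + (a - |u|) = -|u| by ring] at this
    rw [Real.cosh_eq, Real.cosh_eq, Real.sinh_eq]
    linarith
  rw [Real.cosh_abs] at key
  have : a * Real.cosh u ≥ a * (Real.sinh a * |u|) := by
    apply mul_le_mul_of_nonneg_left _ ha.le
    linarith
  calc |u| * Real.cosh a = a * (Real.sinh a * |u|) := by rw [← h]; ring
    _ ≤ a * Real.cosh u := this

theorem mul_sinh_lt_cosh {a u : ℝ} (h : a * Real.sinh a = Real.cosh a) (hu : |u| < a) :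
    u * Real.sinh u < Real.cosh u := by
  have h1 := strictMonoOn_mul_sinh_sub_cosh (abs_nonneg u) ((abs_nonneg u).trans hu.le) hu
  simp only [h, sub_self, Real.cosh_abs] at h1
  rcases abs_cases u with ⟨h2, _⟩ | ⟨h2, _⟩ <;> rw [h2] at h1
  · linarith
  · rw [Real.sinh_neg] at h1; linarith

/-! ### Inverting `u / cosh u` -/

theorem hasDerivAt_div_cosh (u : ℝ) : HasDerivAt (fun u : ℝ => u / Real.cosh u)
    ((Real.cosh u - u * Real.sinh u) / Real.cosh u ^ 2) u := by
  have := (hasDerivAt_id u).div (Real.hasDerivAt_cosh u) (Real.cosh_pos u).ne'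
  convert! this using 1
  simp

theorem contDiff_div_cosh : ContDiff ℝ 1 (fun u : ℝ => u / Real.cosh u) :=
  contDiff_id.div Real.contDiff_cosh fun u => (Real.cosh_pos u).ne'

theorem strictMonoOn_div_cosh {a : ℝ} (h : a * Real.sinh a = Real.cosh a) :
    StrictMonoOn (fun u : ℝ => u / Real.cosh u) (Set.Icc (-a) a) := by
  refine strictMonoOn_of_deriv_pos (convex_Icc _ _) contDiff_div_cosh.continuous.continuousOn
    fun u hu => ?_
  rw [interior_Icc] at hu
  rw [(hasDerivAt_div_cosh u).deriv]
  exact div_pos (sub_pos.2 (mul_sinh_lt_cosh h (abs_lt.2 hu))) (pow_pos (Real.cosh_pos u) 2)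

/-- A strictly monotone continuously differentiable function on an interval whose derivative does
not vanish in the interior has a continuously differentiable inverse. -/
theorem StrictMonoOn.exists_contDiffAt_inverse {f : ℝ → ℝ} {p q : ℝ} (hpq : p ≤ q)
    (hf : ContDiff ℝ 1 f) (hmono : StrictMonoOn f (Set.Icc p q))
    (hd : ∀ x ∈ Set.Ioo p q, deriv f x ≠ 0) :
    ∃ h : ℝ → ℝ, ∀ y ∈ Set.Ioo (f p) (f q),
      h y ∈ Set.Ioo p q ∧ f (h y) = y ∧ ContDiffAt ℝ 1 h y := by
  choose! h hmem heq using fun y (hy : y ∈ Set.Ioo (f p) (f q)) =>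
    intermediate_value_Ioo hpq hf.continuous.continuousOn hy
  refine ⟨h, fun y hy => ⟨hmem y hy, heq y hy, ?_⟩⟩
  have hder : HasDerivAt f (deriv f (h y)) (h y) :=
    ((hf.differentiable one_ne_zero) (h y)).hasDerivAt
  have hF := hder.hasFDerivAt_equiv (hd _ (hmem y hy))
  have hL := hf.contDiffAt.to_localInverse hF one_ne_zero
  have hLx := hf.contDiffAt.localInverse_apply_image hF one_ne_zero
  have hr := (hf.contDiffAt.hasStrictFDerivAt' hF one_ne_zero).eventually_right_inverse
  rw [heq y hy] at hL hLx hr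
  refine hL.congr_of_eventuallyEq ?_
  -- Near y the smooth local inverse takes values in (p, q), so by injectivity it coincides with h
  -- there.
  have h1 := hL.continuousAt.eventually
    (by rw [hLx]; exact Ioo_mem_nhds (hmem y hy).1 (hmem y hy).2)
  filter_upwards [hr, h1, Ioo_mem_nhds hy.1 hy.2] with x hx1 hx2 hx3
  exact hmono.injOn (Set.Ioo_subset_Icc_self (hmem x hx3)) (Set.Ioo_subset_Icc_self hx2)
    ((heq x hx3).trans hx1.symm)

theorem exists_contDiffAt_inverse_div_cosh {a : ℝ} (ha : 0 < a)
    (h : a * Real.sinh a = Real.cosh a) :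
    ∃ f : ℝ → ℝ, ∀ y, |y| < a / Real.cosh a →
      |f y| < a ∧ f y / Real.cosh (f y) = y ∧ ContDiffAt ℝ 1 f y := by
  obtain ⟨f, hf⟩ := (strictMonoOn_div_cosh h).exists_contDiffAt_inverse (by linarith)
    contDiff_div_cosh (fun u hu => by
      rw [(hasDerivAt_div_cosh u).deriv]
      exact (div_pos (sub_pos.2 (mul_sinh_lt_cosh h (abs_lt.2 hu)))
        (pow_pos (Real.cosh_pos u) 2)).ne')
  refine ⟨f, fun y hy => ?_⟩
  obtain ⟨h1, h2, h3⟩ := hf y (by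
    rw [abs_lt] at hy
    simpa [neg_div] using hy)
  exact ⟨abs_lt.2 h1, h2, h3⟩

/-! ### The trajectory joining `1` and `-1` below the critical parameter -/

/-- At a zero of Q the real part gives (λ/2) sinh u sin v = 1; with u = (λ/2) cosh u sin v this
forces u sinh u = cosh u, impossible for |u| < a. -/
theorem one_add_I_mul_cosh_ne_zero {a lam : ℝ} (h : a * Real.sinh a = Real.cosh a) {w : ℂ}
    (hw : |w.re| < a) (hlev : level lam w = 0) :
    1 + Complex.I * (lam / 2) * Complex.cosh w ≠ 0 := by
  intro h0
  have h1 := congrArg Complex.re h0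
  have h2 : (lam / 2 : ℂ) = ((lam / 2 : ℝ) : ℂ) := by push_cast; rfl
  rw [h2] at h1
  simp only [Complex.add_re, Complex.mul_re, Complex.mul_im, Complex.I_re, Complex.I_im,
    Complex.ofReal_re, Complex.ofReal_im, Complex.cosh_im_eq, Complex.one_re,
    Complex.zero_re] at h1
  rw [level_eq] at hlev
  have h3 := mul_sinh_lt_cosh h hw
  have : w.re * Real.sinh w.re = Real.cosh w.re := by
    linear_combination Real.sinh w.re * hlev - Real.cosh w.re * h1
  exact h3.ne this

theorem deriv_ne_zero_of_im {w : ℝ → ℂ} {t d : ℝ} (hw : DifferentiableAt ℝ w t)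
    (hd : HasDerivAt (fun s => (w s).im) d t) (h0 : d ≠ 0) : deriv w t ≠ 0 := by
  intro h
  have h1 := Complex.imCLM.hasFDerivAt.comp_hasDerivAt t hw.hasDerivAt
  rw [h] at h1
  exact h0 (hd.unique (by simpa [Function.comp_def] using h1))

theorem deriv_ne_zero_of_re {w : ℝ → ℂ} {t d : ℝ} (hw : DifferentiableAt ℝ w t)
    (hd : HasDerivAt (fun s => (w s).re) d t) (h0 : d ≠ 0) : deriv w t ≠ 0 := by
  intro h
  have h1 := Complex.reCLM.hasFDerivAt.comp_hasDerivAt t hw.hasDerivAt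
  rw [h] at h1
  exact h0 (hd.unique (by simpa [Function.comp_def] using h1))

theorem sin_pi_div_two_add_arctan_pos (t : ℝ) : 0 < Real.sin (Real.pi / 2 + Real.arctan t) := by
  apply Real.sin_pos_of_pos_of_lt_pi
  · linarith [Real.neg_pi_div_two_lt_arctan t]
  · linarith [Real.arctan_lt_pi_div_two t]

theorem exists_trajectory_joining {a lam : ℝ} (ha : 0 < a) (h : a * Real.sinh a = Real.cosh a)
    (h0 : 0 ≤ lam) (hlt : lam < 2 * a / Real.cosh a) :
    ∃ γ : ℝ → ℂ, IsTrajectory (fun z => -Q lam z) γ ∧ EmanatesFrom γ 1 ∧ EndsAt γ (-1) := by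
  obtain ⟨f, hf⟩ := exists_contDiffAt_inverse_div_cosh ha h
  have hlt' : lam / 2 < a / Real.cosh a := by rw [mul_div_assoc] at hlt; linarith
  have hsmall : ∀ v, |lam / 2 * Real.sin v| < a / Real.cosh a := fun v => by
    rw [abs_mul, abs_of_nonneg (by positivity : 0 ≤ lam / 2)]
    exact (mul_le_of_le_one_right (by positivity) (Real.abs_sin_le_one v)).trans_lt hlt'
  have hfeq : ∀ v, f (lam / 2 * Real.sin v) =
      lam / 2 * Real.cosh (f (lam / 2 * Real.sin v)) * Real.sin v := fun v => by
    have h1 := (hf _ (hsmall v)).2.1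
    rw [div_eq_iff (Real.cosh_pos _).ne'] at h1
    linarith
  have hf0 : f 0 = 0 := by simpa using hfeq 0
  set lift : ℝ → ℂ := fun v => (f (lam / 2 * Real.sin v) : ℂ) + v * Complex.I with hlift
  have hre : ∀ v, (lift v).re = f (lam / 2 * Real.sin v) := fun v => by simp [hlift]
  have him : ∀ v, (lift v).im = v := fun v => by simp [hlift]
  have hlev : ∀ v, level lam (lift v) = 0 := fun v => by
    rw [level_eq, hre, him]
    linarith [hfeq v]
  have hlift_cd : ContDiff ℝ 1 lift := by
    have h1 : ContDiff ℝ 1 (fun v => f (lam / 2 * Real.sin v)) :=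
      contDiff_iff_contDiffAt.2 fun v =>
        (hf _ (hsmall v)).2.2.comp v (contDiff_const.mul Real.contDiff_sin).contDiffAt
    exact (Complex.ofRealCLM.contDiff.comp h1).add (Complex.ofRealCLM.contDiff.mul contDiff_const)
  -- A diffeomorphism of ℝ onto (0, π); the ends v = 0 and v = π lie over z = 1 and z = -1.
  set θ : ℝ → ℝ := fun t => Real.pi / 2 + Real.arctan t with hθ
  have hθ_cd : ContDiff ℝ 1 θ := contDiff_const.add Real.contDiff_arctan
  have hθ_sin : ∀ t, 0 < Real.sin (θ t) := sin_pi_div_two_add_arctan_pos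
  have harc : IsHorizontalArc (fun z => -Q lam z) (fun t => Complex.cosh (lift (θ t))) := by
    refine isHorizontalArc_cosh_comp (hlift_cd.comp hθ_cd) (fun t => hlev _) (fun t => ?_)
      (fun t => ?_) (fun t => ?_)
    · refine deriv_ne_zero_of_im (d := 1 / (1 + t ^ 2))
        ((hlift_cd.comp hθ_cd).differentiable one_ne_zero t) ?_ (by positivity)
      simp only [him]
      exact (Real.hasDerivAt_arctan t).const_add _
    · intro hs
      have := congrArg Complex.im hs
      rw [Complex.sinh_im_eq, him] at this
      exact (mul_pos (Real.cosh_pos _) (hθ_sin t)).ne' this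
    · exact one_add_I_mul_cosh_ne_zero h (by rw [hre]; exact (hf _ (hsmall _)).1) (hlev _)
  refine ⟨_, ⟨harc, fun δ hδ hsub => Set.Subset.antisymm ?_ hsub⟩, ?_, ?_⟩
  · obtain ⟨t₁, ht₁⟩ := hsub ⟨0, rfl⟩
    have hzero : ∀ t, levelSq lam (δ t) = 0 := fun t => by
      rw [hδ.levelSq_eq t t₁, ht₁, levelSq_cosh, hlev]; simp
    -- The ellipse |u| = a misses the zero level, since there |u| / cosh u = a / cosh a > λ/2. By
    -- the intermediate value theorem δ stays inside it.
    have hne : ∀ t, focalMean (δ t) ≠ Real.cosh a := by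
      intro t ht
      obtain ⟨w, hw⟩ := Complex.cosh_surjective (δ t)
      have hl := hzero t
      rw [← hw, levelSq_cosh, sq_eq_zero_iff, level_eq] at hl
      rw [← hw, focalMean_cosh] at ht
      have h1 : |w.re| = a := by
        have h2 : |w.re| ≤ |a| := Real.cosh_le_cosh.1 ht.le
        have h3 : |a| ≤ |w.re| := Real.cosh_le_cosh.1 ht.ge
        rw [abs_of_pos ha] at h2 h3
        exact le_antisymm h2 h3
      have h2 : w.re / Real.cosh a = lam / 2 * Real.sin w.im := by
        rw [div_eq_iff (Real.cosh_pos a).ne', ← ht]; linarith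
      have h3 := hsmall w.im
      rw [← h2, abs_div, h1, abs_of_pos (Real.cosh_pos a)] at h3
      exact lt_irrefl _ h3
    have hlt_all : ∀ t, focalMean (δ t) < Real.cosh a := by
      intro t
      by_contra hge
      have hcont : Continuous fun t => focalMean (δ t) :=
        continuous_focalMean.comp hδ.1.continuous
      have h1 : focalMean (δ t₁) < Real.cosh a := by
        rw [ht₁, focalMean_cosh, hre, Real.cosh_lt_cosh, abs_of_pos ha]
        exact (hf _ (hsmall _)).1
      obtain ⟨s, hs⟩ := mem_range_of_exists_le_of_exists_ge hcont ⟨t₁, h1.le⟩ ⟨t, not_lt.1 hge⟩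
      exact hne s hs
    have key : ∀ w : ℂ, level lam w = 0 → |w.re| < a → 0 < Real.sin w.im →
        ∃ t, Complex.cosh (lift (θ t)) = Complex.cosh w := by
      intro w hl hwa hsin
      rw [level_eq] at hl
      -- The representative of Im w modulo 2π in (0, π), available because the sine is positive.
      set v := Real.arccos (Real.cos w.im) with hv
      have hvc : Real.cos v = Real.cos w.im :=
        Real.cos_arccos (Real.neg_one_le_cos _) (Real.cos_le_one _)
      have hvs : Real.sin v = Real.sin w.im := by
        rw [hv, Real.sin_arccos, ← Real.sin_sq, Real.sqrt_sq hsin.le]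
      have hv0 : 0 < v := by
        refine lt_of_le_of_ne (Real.arccos_nonneg _) fun h0 => ?_
        rw [← hvs, ← h0, Real.sin_zero] at hsin
        exact lt_irrefl _ hsin
      have hvpi : v < Real.pi := by
        refine lt_of_le_of_ne (Real.arccos_le_pi _) fun h0 => ?_
        rw [← hvs, h0, Real.sin_pi] at hsin
        exact lt_irrefl _ hsin
      have hθv : θ (Real.tan (v - Real.pi / 2)) = v := by
        simp only [hθ]
        rw [Real.arctan_tan (by linarith) (by linarith)]
        ring
      refine ⟨Real.tan (v - Real.pi / 2), ?_⟩
      rw [hθv]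
      refine cosh_eq_cosh_of_re_of_cos_of_sin ?_ (by rw [him, hvc]) (by rw [him, hvs])
      have hfv := hf _ (hsmall v)
      rw [hre]
      refine (strictMonoOn_div_cosh h).injOn (abs_le.1 hfv.1.le) (abs_le.1 hwa.le) ?_
      simp only [hfv.2.1]
      rw [eq_div_iff (Real.cosh_pos _).ne', hvs]
      linarith
    rintro _ ⟨t, rfl⟩
    obtain ⟨w, hw⟩ := Complex.cosh_surjective (δ t)
    have hl := hzero t
    have hwa := hlt_all t
    rw [← hw, levelSq_cosh, sq_eq_zero_iff] at hl
    rw [← hw, focalMean_cosh, Real.cosh_lt_cosh, abs_of_pos ha] at hwa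
    rw [← hw]
    rcases lt_trichotomy (Real.sin w.im) 0 with hs | hs | hs
    · rw [← Complex.cosh_neg]
      exact key (-w) (by rw [level_neg, hl, neg_zero]) (by simpa using hwa) (by simpa using hs)
    -- Zero sine on the zero level forces u = 0, hence z = ±1, which no arc meets.
    · exfalso
      rw [level_eq, hs, mul_zero, sub_zero] at hl
      refine Complex.sinh_ne_zero_of_cosh_ne (hw ▸ hδ.ne_one t) (hw ▸ hδ.ne_neg_one t) ?_
      rw [Complex.sinh_eq_re_im, hl, hs]; simp
    · exact key w hl hwa hs
  · have h1 : Tendsto θ atBot (𝓝 0) := by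
      have := (tendsto_nhds_of_tendsto_nhdsWithin Real.tendsto_arctan_atBot).const_add (Real.pi / 2)
      simpa [hθ] using this
    have h2 := ((Complex.continuous_cosh.comp hlift_cd.continuous).tendsto 0).comp h1
    simpa [hlift, hf0, Function.comp_def, EmanatesFrom] using h2
  · have h1 : Tendsto θ atTop (𝓝 Real.pi) := by
      have := (tendsto_nhds_of_tendsto_nhdsWithin Real.tendsto_arctan_atTop).const_add (Real.pi / 2)
      simpa [hθ] using this
    have h2 := ((Complex.continuous_cosh.comp hlift_cd.continuous).tendsto Real.pi).comp h1
    simpa [hlift, hf0, Function.comp_def, EndsAt, Complex.cosh_mul_I] using h2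

/-! ### Trajectories escaping to infinity above the critical parameter -/

/-- The angle `v` with `sin v = s / (lam / 2 * cosh s)`. -/
noncomputable def escapeAngle (lam s : ℝ) : ℝ := Real.arcsin (s / (lam / 2 * Real.cosh s))

/-- The zero level curve in the `w`-plane, parametrized by its real part. -/
noncomputable def escapeLift (lam s : ℝ) : ℂ := s + escapeAngle lam s * Complex.I

theorem escapeLift_re (lam s : ℝ) : (escapeLift lam s).re = s := by simp [escapeLift]

theorem escapeLift_im (lam s : ℝ) : (escapeLift lam s).im = escapeAngle lam s := by
  simp [escapeLift]

section

variable {lam : ℝ}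

/-- The hypothesis `hb` is the supercritical condition λ/2 > max |u| / cosh u; it keeps the argument
of `arcsin` off ±1, where smoothness would fail. -/
theorem abs_div_lt_one_of_lt (hb : ∀ u : ℝ, |u| < lam / 2 * Real.cosh u) (s : ℝ) :
    |s / (lam / 2 * Real.cosh s)| < 1 := by
  have h := (abs_nonneg s).trans_lt (hb s)
  rw [abs_div, abs_of_pos h, div_lt_one h]
  exact hb s

theorem sin_escapeAngle (hb : ∀ u : ℝ, |u| < lam / 2 * Real.cosh u) (s : ℝ) :
    Real.sin (escapeAngle lam s) = s / (lam / 2 * Real.cosh s) :=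
  have h := abs_lt.1 (abs_div_lt_one_of_lt hb s)
  Real.sin_arcsin h.1.le h.2.le

theorem cos_escapeAngle_pos (hb : ∀ u : ℝ, |u| < lam / 2 * Real.cosh u) (s : ℝ) :
    0 < Real.cos (escapeAngle lam s) := by
  rw [escapeAngle, Real.cos_arcsin, Real.sqrt_pos, sub_pos, sq_lt_one_iff_abs_lt_one]
  exact abs_div_lt_one_of_lt hb s

theorem level_escapeLift (hb : ∀ u : ℝ, |u| < lam / 2 * Real.cosh u) (s : ℝ) :
    level lam (escapeLift lam s) = 0 := by
  have h := (abs_nonneg s).trans_lt (hb s)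
  rw [level_eq, escapeLift_re, escapeLift_im, sin_escapeAngle hb, mul_div_cancel₀ _ h.ne', sub_self]

theorem contDiff_escapeLift (hb : ∀ u : ℝ, |u| < lam / 2 * Real.cosh u) :
    ContDiff ℝ 1 (escapeLift lam) := by
  have h1 : ContDiff ℝ 1 (escapeAngle lam) := by
    refine contDiff_iff_contDiffAt.2 fun s => ?_
    have h := abs_lt.1 (abs_div_lt_one_of_lt hb s)
    refine (Real.contDiffAt_arcsin h.1.ne' h.2.ne).comp s ?_
    exact contDiffAt_id.div (contDiff_const.mul Real.contDiff_cosh).contDiffAt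
      ((abs_nonneg s).trans_lt (hb s)).ne'
  exact Complex.ofRealCLM.contDiff.add ((Complex.ofRealCLM.contDiff.comp h1).mul contDiff_const)

theorem cosh_escapeLift_re_pos (hb : ∀ u : ℝ, |u| < lam / 2 * Real.cosh u) (s : ℝ) :
    0 < (Complex.cosh (escapeLift lam s)).re := by
  rw [Complex.cosh_re_eq, escapeLift_im]
  exact mul_pos (Real.cosh_pos _) (cos_escapeAngle_pos hb s)

/-- The parameter exp t keeps u > 0, which excludes the pole 1. The zero 2i/λ of Q is on the
imaginary axis, while the curve has positive real part. -/
theorem isHorizontalArc_escape (hb : ∀ u : ℝ, |u| < lam / 2 * Real.cosh u) :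
    IsHorizontalArc (fun z => -Q lam z) (fun t => Complex.cosh (escapeLift lam (Real.exp t))) := by
  have hcd := (contDiff_escapeLift hb).comp Real.contDiff_exp
  have hlam : 0 < lam := by have := hb 0; simp at this; exact this
  refine isHorizontalArc_cosh_comp hcd (fun t => level_escapeLift hb _) (fun t => ?_)
    (fun t => ?_) (fun t => ?_)
  · refine deriv_ne_zero_of_re (d := Real.exp t) (hcd.differentiable one_ne_zero t) ?_
      (Real.exp_pos t).ne'
    simp only [escapeLift_re]
    exact Real.hasDerivAt_exp t
  · intro h
    have := congrArg Complex.re h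
    rw [Complex.sinh_eq_re_im] at this
    simp only [Complex.add_re, Complex.re_ofReal_mul, Complex.I_re, Complex.ofReal_re, mul_zero,
      add_zero, escapeLift_re, escapeLift_im, Complex.zero_re] at this
    exact (mul_pos (Real.sinh_pos_iff.2 (Real.exp_pos t)) (cos_escapeAngle_pos hb _)).ne' this
  · intro h
    have h1 := congrArg Complex.im h
    have h2 : (lam / 2 : ℂ) = ((lam / 2 : ℝ) : ℂ) := by push_cast; rfl
    rw [h2] at h1
    simp only [Complex.add_im, Complex.mul_re, Complex.mul_im, Complex.I_re, Complex.I_im,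
      Complex.ofReal_re, Complex.ofReal_im, Complex.one_im, Complex.zero_im] at h1
    have := mul_pos (half_pos hlam) (cosh_escapeLift_re_pos hb (Real.exp t))
    linarith

/-- On the imaginary axis sin v = ±1, so zero level would give |u| = (λ/2) cosh u, against `hb`. -/
theorem cosh_re_ne_zero_of_level_eq_zero (hb : ∀ u : ℝ, |u| < lam / 2 * Real.cosh u) {w : ℂ}
    (hw : level lam w = 0) : (Complex.cosh w).re ≠ 0 := by
  intro h
  rw [Complex.cosh_re_eq, mul_eq_zero] at h
  have hc := h.resolve_left (Real.cosh_pos _).ne'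
  have hs : |Real.sin w.im| = 1 := by
    have h1 := Real.sin_sq w.im
    rw [hc] at h1
    rw [← sq_eq_sq₀ (abs_nonneg _) zero_le_one, sq_abs, h1]; norm_num
  rw [level_eq, sub_eq_zero] at hw
  have h1 := hb w.re
  have h2 := (abs_nonneg _).trans_lt h1
  have h3 := congrArg abs hw
  rw [abs_mul, hs, mul_one, abs_of_pos h2] at h3
  exact h1.ne h3

theorem exists_escapeLift_eq (hb : ∀ u : ℝ, |u| < lam / 2 * Real.cosh u) {w : ℂ}
    (hw : level lam w = 0) (hre : 0 < (Complex.cosh w).re) (hne : Complex.cosh w ≠ 1) :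
    ∃ s, 0 < s ∧ Complex.cosh (escapeLift lam s) = Complex.cosh w := by
  have key : ∀ w : ℂ, level lam w = 0 → 0 < (Complex.cosh w).re →
      Complex.cosh (escapeLift lam w.re) = Complex.cosh w := by
    intro w hw hre
    rw [Complex.cosh_re_eq] at hre
    have hc : 0 < Real.cos w.im := pos_of_mul_pos_right hre (Real.cosh_pos _).le
    have h := (abs_nonneg _).trans_lt (hb w.re)
    have hs : Real.sin (escapeAngle lam w.re) = Real.sin w.im := by
      rw [sin_escapeAngle hb, div_eq_iff h.ne']
      rw [level_eq] at hw
      linarith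
    refine cosh_eq_cosh_of_re_of_cos_of_sin (escapeLift_re _ _) ?_ (by rw [escapeLift_im, hs])
    rw [escapeLift_im]
    refine (sq_eq_sq₀ (cos_escapeAngle_pos hb _).le hc.le).1 ?_
    rw [Real.cos_sq', Real.cos_sq', hs]
  -- Both w and -w lie over z, so u may be taken nonnegative; u = 0 gives only the excluded point 1.
  rcases lt_trichotomy w.re 0 with h | h | h
  · refine ⟨(-w).re, by simpa using h, ?_⟩
    rw [key (-w) (by rw [level_neg, hw, neg_zero]) (by rwa [Complex.cosh_neg]), Complex.cosh_neg]
  · refine absurd ?_ hne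
    rw [← key w hw hre, h]
    simp [escapeLift, escapeAngle]
  · exact ⟨w.re, h, key w hw hre⟩

theorem IsHorizontalArc.exists_eq_escape (hb : ∀ u : ℝ, |u| < lam / 2 * Real.cosh u) {δ : ℝ → ℂ}
    (hδ : IsHorizontalArc (fun z => -Q lam z) δ) {t₁ : ℝ} (hlev : levelSq lam (δ t₁) = 0)
    (hre : 0 < (δ t₁).re) (t : ℝ) : ∃ s, 0 < s ∧ Complex.cosh (escapeLift lam s) = δ t := by
  have hzero : ∀ t, ∃ w, level lam w = 0 ∧ Complex.cosh w = δ t := fun t => by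
    obtain ⟨w, hw⟩ := Complex.cosh_surjective (δ t)
    refine ⟨w, ?_, hw⟩
    rw [← sq_eq_zero_iff, ← levelSq_cosh, hw, hδ.levelSq_eq t t₁, hlev]
  have hpos : 0 < (δ t).re := by
    by_contra hge
    obtain ⟨s, hs⟩ := mem_range_of_exists_le_of_exists_ge
      (Complex.continuous_re.comp hδ.1.continuous) ⟨t, not_lt.1 hge⟩ ⟨t₁, hre.le⟩
    obtain ⟨w, hw, hws⟩ := hzero s
    refine cosh_re_ne_zero_of_level_eq_zero hb hw ?_
    rw [hws]; exact hs
  obtain ⟨w, hw, hwt⟩ := hzero t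
  obtain ⟨s, hs, h⟩ := exists_escapeLift_eq hb hw (hwt ▸ hpos) (hwt ▸ hδ.ne_one t)
  exact ⟨s, hs, h.trans hwt⟩

theorem range_subset_range_escape (hb : ∀ u : ℝ, |u| < lam / 2 * Real.cosh u) {δ : ℝ → ℂ}
    (hδ : IsHorizontalArc (fun z => -Q lam z) δ) {t₁ : ℝ} (hlev : levelSq lam (δ t₁) = 0)
    (hre : 0 < (δ t₁).re) :
    Set.range δ ⊆ Set.range (fun t => Complex.cosh (escapeLift lam (Real.exp t))) := by
  rintro _ ⟨t, rfl⟩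
  obtain ⟨s, hs, h⟩ := hδ.exists_eq_escape hb hlev hre t
  exact ⟨Real.log s, by simp only [Real.exp_log hs, h]⟩

theorem isTrajectory_escape (hb : ∀ u : ℝ, |u| < lam / 2 * Real.cosh u) :
    IsTrajectory (fun z => -Q lam z) (fun t => Complex.cosh (escapeLift lam (Real.exp t))) := by
  refine ⟨isHorizontalArc_escape hb, fun δ hδ hsub => Set.Subset.antisymm ?_ hsub⟩
  obtain ⟨t₁, ht₁⟩ := hsub ⟨0, rfl⟩
  refine range_subset_range_escape hb hδ (t₁ := t₁) ?_ ?_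
  · rw [ht₁, levelSq_cosh, level_escapeLift hb]; simp
  · rw [ht₁]; exact cosh_escapeLift_re_pos hb _

theorem emanatesFrom_escape (hb : ∀ u : ℝ, |u| < lam / 2 * Real.cosh u) :
    EmanatesFrom (fun t => Complex.cosh (escapeLift lam (Real.exp t))) 1 := by
  have h := ((Complex.continuous_cosh.comp (contDiff_escapeLift hb).continuous).tendsto 0).comp
    Real.tendsto_exp_atBot
  simpa [escapeLift, escapeAngle, Function.comp_def, EmanatesFrom] using h

theorem tendsto_escapeAngle_atTop (hb : ∀ u : ℝ, |u| < lam / 2 * Real.cosh u) :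
    Tendsto (escapeAngle lam) atTop (𝓝 0) := by
  have hlam : 0 < lam := by have := hb 0; simp at this; exact this
  have h1 : Tendsto (fun s : ℝ => s / (lam / 2 * Real.cosh s)) atTop (𝓝 0) := by
    -- The factor 4/λ comes from cosh s ≥ exp(s) / 2.
    have h2 := (Real.tendsto_pow_mul_exp_neg_atTop_nhds_zero 1).const_mul (4 / lam)
    rw [mul_zero] at h2
    refine squeeze_zero' ?_ ?_ h2
    · filter_upwards [eventually_ge_atTop 0] with s hs
      have := Real.cosh_pos s
      positivity
    · filter_upwards [eventually_ge_atTop 0] with s hs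
      have h3 : Real.exp s ≤ 2 * Real.cosh s := by
        rw [Real.cosh_eq]; linarith [Real.exp_pos (-s)]
      have h4 : s / (lam / 2 * Real.cosh s) ≤ s / (lam / 4 * Real.exp s) := by
        apply div_le_div_of_nonneg_left hs (by positivity)
        nlinarith
      refine h4.trans_eq ?_
      rw [Real.exp_neg]
      field_simp
  have h2 := (Real.continuous_arcsin.tendsto 0).comp h1
  rwa [Real.arcsin_zero] at h2

theorem tendsto_cosh_escapeLift (hb : ∀ u : ℝ, |u| < lam / 2 * Real.cosh u) :
    Tendsto (fun s => ‖Complex.cosh (escapeLift lam s)‖) atTop atTop ∧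
    Tendsto (fun s => Complex.cosh (escapeLift lam s) /
      (‖Complex.cosh (escapeLift lam s)‖ : ℂ)) atTop (𝓝 1) := by
  have hθ := tendsto_escapeAngle_atTop hb
  have hcos : Tendsto (fun s => Real.cos (escapeAngle lam s)) atTop (𝓝 1) := by
    simpa [Function.comp_def] using (Real.continuous_cos.tendsto 0).comp hθ
  have hsin : Tendsto (fun s => Real.sinh s / Real.cosh s * Real.sin (escapeAngle lam s))
      atTop (𝓝 0) := by
    have h0 : Tendsto (fun s => |Real.sin (escapeAngle lam s)|) atTop (𝓝 0) := by
      simpa using ((Real.continuous_sin.tendsto 0).comp hθ).abs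
    refine squeeze_zero_norm (fun s => ?_) h0
    rw [Real.norm_eq_abs, abs_mul]
    refine mul_le_of_le_one_left (abs_nonneg _) ?_
    rw [abs_div, abs_of_pos (Real.cosh_pos s), div_le_one (Real.cosh_pos s)]
    rw [← sq_le_sq₀ (abs_nonneg _) (Real.cosh_pos s).le, sq_abs, Real.cosh_sq]
    linarith
  -- The quotient is cos v + i tanh s sin v with v → 0; both the growth and the direction follow
  -- from this limit.
  have hquot : Tendsto (fun s => Complex.cosh (escapeLift lam s) / (Real.cosh s : ℂ))
      atTop (𝓝 1) := by
    have h := ((Complex.continuous_ofReal.tendsto 1).comp hcos).add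
      (((Complex.continuous_ofReal.tendsto 0).comp hsin).mul_const Complex.I)
    simp only [Complex.ofReal_one, Complex.ofReal_zero, zero_mul, add_zero] at h
    refine h.congr fun s => ?_
    have hne : (Real.cosh s : ℂ) ≠ 0 := Complex.ofReal_ne_zero.2 (Real.cosh_pos s).ne'
    rw [Complex.cosh_eq_re_im, escapeLift_re, escapeLift_im]
    simp only [Function.comp_apply, Complex.ofReal_mul, Complex.ofReal_div]
    field_simp
  have hnorm : Tendsto (fun s => ‖Complex.cosh (escapeLift lam s) / (Real.cosh s : ℂ)‖)
      atTop (𝓝 1) := by simpa using hquot.norm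
  have hcosh : Tendsto Real.cosh atTop atTop :=
    tendsto_atTop_mono' _ ((eventually_ge_atTop 0).mono fun s hs =>
      (Real.self_le_sinh_iff.2 hs).trans (Real.sinh_lt_cosh s).le) tendsto_id
  have hne : ∀ s, (Real.cosh s : ℂ) ≠ 0 := fun s =>
    Complex.ofReal_ne_zero.2 (Real.cosh_pos s).ne'
  have hnorm_eq : ∀ s, ‖Complex.cosh (escapeLift lam s) / (Real.cosh s : ℂ)‖ =
      ‖Complex.cosh (escapeLift lam s)‖ / Real.cosh s := fun s => by
    rw [norm_div, Complex.norm_real, Real.norm_eq_abs, abs_of_pos (Real.cosh_pos s)]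
  constructor
  · refine (hcosh.atTop_mul_pos one_pos hnorm).congr fun s => ?_
    rw [hnorm_eq, mul_div_cancel₀ _ (Real.cosh_pos s).ne']
  · have h := hquot.div ((Complex.continuous_ofReal.tendsto 1).comp hnorm) (by simp)
    simp only [Complex.ofReal_one, div_one] at h
    refine h.congr fun s => ?_
    simp only [Pi.div_apply, Function.comp_apply, hnorm_eq, Complex.ofReal_div]
    exact div_div_div_cancel_right₀ (hne s) _ _

/-! ### Every trajectory from 1 follows the escaping curve -/

theorem IsTrajectory.divergesInDirection_one (hb : ∀ u : ℝ, |u| < lam / 2 * Real.cosh u)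
    {γ : ℝ → ℂ} (hγ : IsTrajectory (fun z => -Q lam z) γ) (h1 : EmanatesFrom γ 1) :
    DivergesInDirection γ 1 := by
  have hlev : ∀ t, levelSq lam (γ t) = 0 := fun t =>
    tendsto_nhds_unique
      (tendsto_const_nhds.congr fun s => hγ.1.levelSq_eq t s)
      ((tendsto_levelSq_nhds_one lam).comp h1)
  obtain ⟨t₁, ht₁⟩ : ∃ t, 0 < (γ t).re :=
    (((Complex.continuous_re.tendsto 1).comp h1).eventually
      (lt_mem_nhds (by simp : (0 : ℝ) < (1 : ℂ).re))).exists
  -- Maximality of γ makes it fill the whole escaping curve, not just a piece of it.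
  have hrange := hγ.2 _ (isHorizontalArc_escape hb)
    (range_subset_range_escape hb hγ.1 (hlev t₁) ht₁)
  -- S is the position of γ along the escaping curve. Its derivative cannot vanish since that of γ
  -- does not, so Rolle makes it injective; starting at 1 excludes decrease, and surjectivity onto
  -- the curve makes it unbounded.
  set S : ℝ → ℝ := fun t => Real.arcosh (focalMean (γ t)) with hS
  have hS_of : ∀ {t s}, 0 < s → Complex.cosh (escapeLift lam s) = γ t → S t = s := by
    intro t s hs h
    simp only [hS, ← h, focalMean_cosh, escapeLift_re, Real.arcosh_cosh hs.le]
  have hSγ : ∀ t, 0 < S t ∧ Complex.cosh (escapeLift lam (S t)) = γ t := fun t => by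
    obtain ⟨s, hs, h⟩ := hγ.1.exists_eq_escape hb (hlev t₁) ht₁ t
    rw [hS_of hs h]
    exact ⟨hs, h⟩
  have hfocal : ∀ t, focalMean (γ t) = Real.cosh (S t) := fun t => by
    conv_lhs => rw [← (hSγ t).2]
    rw [focalMean_cosh, escapeLift_re]
  have hγd : Differentiable ℝ γ := hγ.1.1.differentiable one_ne_zero
  have hSd : Differentiable ℝ S := fun t => by
    refine (Real.differentiableAt_arcosh ?_).comp t ?_
    · rw [Set.mem_Ioi, hfocal, Real.one_lt_cosh]
      exact (hSγ t).1.ne'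
    · have e1 := ((hγd t).sub_const 1).norm ℝ (sub_ne_zero.2 (hγ.1.ne_one t))
      have e2 := ((hγd t).add_const 1).norm ℝ (fun h => hγ.1.ne_neg_one t (eq_neg_of_add_eq_zero_left h))
      exact (e1.add e2).div_const 2
  have hSd0 : ∀ t, deriv S t ≠ 0 := fun t h0 => by
    have hE : Differentiable ℝ fun s => Complex.cosh (escapeLift lam s) :=
      ((Complex.contDiff_cosh.restrict_scalars ℝ).comp
        (contDiff_escapeLift hb)).differentiable one_ne_zero
    have h2 := HasDerivAt.scomp t (hE (S t)).hasDerivAt (hSd t).hasDerivAt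
    have h3 : (fun s => Complex.cosh (escapeLift lam s)) ∘ S = γ := funext fun t => (hSγ t).2
    rw [h3, h0, zero_smul] at h2
    exact hγ.1.deriv_ne_zero t h2.deriv
  have hinj : Function.Injective S := by
    intro s t hst
    by_contra hne
    wlog hlt : s < t generalizing s t
    · exact this hst.symm (Ne.symm hne) (lt_of_le_of_ne (not_lt.1 hlt) (Ne.symm hne))
    obtain ⟨c, -, hc⟩ := exists_deriv_eq_zero hlt hSd.continuous.continuousOn hst
    exact hSd0 c hc
  have hmono : StrictMono S := by
    refine (hSd.continuous.strictMono_of_inj hinj).resolve_right fun hanti => ?_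
    have h2 : Tendsto (fun t => focalMean (γ t)) atBot (𝓝 1) := by
      have := (continuous_focalMean.tendsto 1).comp h1
      have e : focalMean 1 = 1 := by norm_num [focalMean]
      rwa [e] at this
    have h3 : Real.cosh (S 0) ≤ 1 := by
      refine ge_of_tendsto h2 ((eventually_le_atBot 0).mono fun t ht => ?_)
      rw [hfocal, Real.cosh_le_cosh, abs_of_pos (hSγ 0).1, abs_of_pos (hSγ t).1]
      exact hanti.antitone ht
    exact h3.not_gt (Real.one_lt_cosh.2 (hSγ 0).1.ne')
  have htop : Tendsto S atTop atTop := by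
    refine tendsto_atTop_atTop_of_monotone hmono.monotone fun b => ?_
    obtain ⟨t, ht⟩ : Complex.cosh (escapeLift lam (Real.exp b)) ∈ Set.range γ :=
      hrange ▸ ⟨b, rfl⟩
    refine ⟨t, ?_⟩
    rw [hS_of (Real.exp_pos b) ht.symm]
    linarith [Real.add_one_le_exp b]
  have h := tendsto_cosh_escapeLift hb
  refine ⟨(h.1.comp htop).congr fun t => ?_, (h.2.comp htop).congr fun t => ?_⟩ <;>
    simp only [Function.comp_apply, (hSγ t).2]

end

/-! ### The symmetry `z ↦ -conj z` -/

/-- The reflection preserves -Q dz² > 0, exchanges the poles 1 and -1, and exchanges the directions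
1 and -1. -/
theorem Q_neg_conj (lam : ℝ) (z : ℂ) :
    Q lam (-(starRingEnd ℂ) z) = (starRingEnd ℂ) (Q lam z) := by
  simp [Q, map_ofNat]

theorem IsHorizontalArc.neg_conj {lam : ℝ} {γ : ℝ → ℂ}
    (h : IsHorizontalArc (fun z => -Q lam z) γ) :
    IsHorizontalArc (fun z => -Q lam z) (fun t => -(starRingEnd ℂ) (γ t)) := by
  refine ⟨(Complex.conjCLE.contDiff.comp h.1).neg, fun t => ?_⟩
  have hd : deriv (fun t => -(starRingEnd ℂ) (γ t)) t = -(starRingEnd ℂ) (deriv γ t) := by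
    have h1 := ((h.1.differentiable one_ne_zero) t).hasDerivAt
    exact (Complex.conjCLE.hasFDerivAt.comp_hasDerivAt t h1).neg.deriv
  have e : -Q lam (-(starRingEnd ℂ) (γ t)) * (-(starRingEnd ℂ) (deriv γ t)) ^ 2 =
      (starRingEnd ℂ) (-Q lam (γ t) * (deriv γ t) ^ 2) := by
    rw [Q_neg_conj]; simp
  have ht := h.2 t
  simp only [hd, e, Complex.conj_im, Complex.conj_re]
  exact ⟨by rw [ht.1, neg_zero], ht.2⟩

theorem IsTrajectory.neg_conj {lam : ℝ} {γ : ℝ → ℂ}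
    (h : IsTrajectory (fun z => -Q lam z) γ) :
    IsTrajectory (fun z => -Q lam z) (fun t => -(starRingEnd ℂ) (γ t)) := by
  refine ⟨h.1.neg_conj, fun δ hδ hsub => Set.Subset.antisymm ?_ hsub⟩
  have h1 := h.2 _ hδ.neg_conj (by
    rintro _ ⟨t, rfl⟩
    obtain ⟨s, hs⟩ := hsub ⟨t, rfl⟩
    exact ⟨s, by simp [hs]⟩)
  rintro _ ⟨t, rfl⟩
  obtain ⟨s, hs⟩ : -(starRingEnd ℂ) (δ t) ∈ Set.range γ := h1 ▸ ⟨t, rfl⟩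
  exact ⟨s, by simp [hs]⟩

theorem EmanatesFrom.neg_conj {γ : ℝ → ℂ} {a : ℂ} (h : EmanatesFrom γ a) :
    EmanatesFrom (fun t => -(starRingEnd ℂ) (γ t)) (-(starRingEnd ℂ) a) :=
  ((Complex.continuous_conj.tendsto a).comp h).neg

theorem DivergesInDirection.neg_conj {γ : ℝ → ℂ} {u : ℂ} (h : DivergesInDirection γ u) :
    DivergesInDirection (fun t => -(starRingEnd ℂ) (γ t)) (-(starRingEnd ℂ) u) := by
  refine ⟨by simpa using h.1, ?_⟩
  refine ((Complex.continuous_conj.tendsto u).comp h.2).neg.congr fun t => ?_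
  simp [neg_div]

theorem mainTheorem4 :
    (∃! lam₀ : ℝ, 0 < lam₀ ∧ hFun lam₀ = 0) ∧
    ∀ lam₀ : ℝ, 0 < lam₀ → hFun lam₀ = 0 →
      (∀ lam : ℝ, 0 ≤ lam → lam < lam₀ →
        ∃ γ : ℝ → ℂ, IsTrajectory (fun z => -Q lam z) γ ∧ EmanatesFrom γ 1 ∧ EndsAt γ (-1)) ∧
      (∀ lam : ℝ, lam₀ < lam →
        (∃ γ : ℝ → ℂ, IsTrajectory (fun z => -Q lam z) γ ∧ EmanatesFrom γ 1) ∧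
        (∃ γ : ℝ → ℂ, IsTrajectory (fun z => -Q lam z) γ ∧ EmanatesFrom γ (-1)) ∧
        ∃ u : ℂ, ‖u‖ = 1 ∧
          (∀ γ : ℝ → ℂ, IsTrajectory (fun z => -Q lam z) γ → EmanatesFrom γ 1 →
            DivergesInDirection γ u) ∧
          (∀ γ : ℝ → ℂ, IsTrajectory (fun z => -Q lam z) γ → EmanatesFrom γ (-1) →
            DivergesInDirection γ (-u))) := by
  obtain ⟨a, ha, h⟩ := exists_mul_sinh_eq_cosh
  have hpos : 0 < 2 * a / Real.cosh a := div_pos (by linarith) (Real.cosh_pos a)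
  refine ⟨⟨2 * a / Real.cosh a, ⟨hpos, (hFun_eq_zero_iff ha h hpos).2 rfl⟩,
    fun lam hlam => (hFun_eq_zero_iff ha h hlam.1).1 hlam.2⟩, fun lam₀ h₀ hz => ?_⟩
  obtain rfl := (hFun_eq_zero_iff ha h h₀).1 hz
  refine ⟨fun lam h0 hlt => exists_trajectory_joining ha h h0 hlt, fun lam hlt => ?_⟩
  -- The maximum a / cosh a of |u| / cosh u equals λ₀/2, which is less than λ/2.
  have hb : ∀ u : ℝ, |u| < lam / 2 * Real.cosh u := fun u => by
    have h1 := abs_mul_cosh_le ha h u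
    rw [div_lt_iff₀ (Real.cosh_pos a)] at hlt
    have h2 := mul_lt_mul_of_pos_right hlt (Real.cosh_pos u)
    refine lt_of_mul_lt_mul_right ?_ (Real.cosh_pos a).le
    linarith
  refine ⟨⟨_, isTrajectory_escape hb, emanatesFrom_escape hb⟩,
    ⟨_, (isTrajectory_escape hb).neg_conj, by simpa using (emanatesFrom_escape hb).neg_conj⟩,
    1, by simp, fun γ hγ h1 => hγ.divergesInDirection_one hb h1, fun γ hγ h1 => ?_⟩
  -- Reflect a trajectory from -1 to one from 1, then reflect its direction back.
  have h2 := (hγ.neg_conj.divergesInDirection_one hb (by simpa using h1.neg_conj)).neg_conj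
  simpa using h2
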